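/- Let $f:\mathbb{R}^n\to\mathbb{R}^n$ be continuously differentiable, let $T>0$, and let $\tilde x$ be a simple cycle of $\dot x=f(x)$, that is, a nonconstant $T$-periodic solution such that the multiplier $+1$ of the $T$-periodic linear system $\dot y=f'(\tilde x(t))y$ has algebraic multiplicity $1$. Let $z_1,\dots,z_{n-1}$ be linearly independent solutions, none of them $T$-periodic, of the adjoint system $\dot z=-(f'(\tilde x(t)))^*z$ with $\langle\dot{\tilde x}(0),z_i(0)\rangle=0$ for all $i$, and let $Z_{n-1}(t)=(z_1(t),\dots,z_{n-1}(t))$ be the $n\times(n-1)$ matrix with these columns. Then there exist a nonsingular $(n-1)\times(n-1)$ matrix $D$ and a continuously differentiable map $I:\mathbb{R}\times\mathbb{R}^{n-1}\to\mathbb{R}^n$, depending only on $f$, $T$, $\tilde x$ and $z_1,\dots,z_{n-1}$, such that for every $\theta\in[0,T]$ the map $I(\theta,\cdot)$ is a smooth surface ($C^1$, injective, with injective derivative at every point) which crosses the cycle transversally at $I(\theta,0)=\tilde x(\theta)$, i.e. $\dot{\tilde x}(\theta)\notin I'_r(\theta,0)\mathbb{R}^{n-1}$, and such that the following holds. Let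 $g:\mathbb{R}\times\mathbb{R}^n\times[0,1]\to\mathbb{R}^n$ be continuous and $T$-periodic in its first variable, let $\varepsilon_k\in(0,1]$ with $\varepsilon_k\to0$, and let $x_k$ be $T$-periodic solutions of $\dot x=f(x)+\varepsilon_k g(t,x,\varepsilon_k)$ such that $x_k(t)\to\tilde x(t)$ as $k\to\infty$ for every $t$. Put $$M^\perp(s)=\int_{s-T}^{s}Z_{n-1}^*(\tau)\,g(\tau,\tilde x(\tau),0)\,d\tau .$$ Then there are functions $\Delta_k:\mathbb{R}\to\mathbb{R}$, with $\Delta_k(\theta)\to0$ as $k\to\infty$ uniformly in $\theta\in[0,T]$, such that $$Z_{n-1}^*(\theta)\bigl(x_k(\theta-\Delta_k(\theta))-\tilde x(\theta)\bigr)=\varepsilon_k D M^\perp(\theta)+o(\varepsilon_k)$$ for $\theta\in[0,T]$, where $o(\varepsilon_k)/\varepsilon_k\to0$ as $k\to\infty$ uniformly in $\theta\in[0,T]$. Moreover, for all sufficiently large $k$ and all $\theta\in[0,T]$, the point $x_k(\theta-\Delta_k(\theta))$ lies in $I(\theta,B_1^{n-1}(0))$, where $B_1^{n-1}(0)$ is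 the open unit ball of $\mathbb{R}^{n-1}$. -/

import Mathlib

open Set Filter Topology MeasureTheory Matrix

/-- `x` is a cycle of period `T` of the autonomous system `x' = f(x)`: a nonconstant
`T`-periodic solution on the whole line (`T` need not be the least period). -/
structure IsCycle {n : ℕ} (f : EuclideanSpace ℝ (Fin n) → EuclideanSpace ℝ (Fin n))
    (T : ℝ) (x : ℝ → EuclideanSpace ℝ (Fin n)) : Prop where
  period_pos : 0 < T
  isSolution : ∀ t, HasDerivAt x (f (x t)) t
  periodic : Function.Periodic x T
  nonconstant : ∃ s t, x s ≠ x t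

/-- `M` is the operator at time `T` of the linear system `y' = A(t) y`, i.e. `M = Y(T)`, where `Y`
is the fundamental operator solution with `Y(0) = id`. For `T`-periodic `A` the eigenvalues of `M`
are the multipliers of the system. -/
def IsMonodromy {n : ℕ}
    (A : ℝ → EuclideanSpace ℝ (Fin n) →L[ℝ] EuclideanSpace ℝ (Fin n)) (T : ℝ)
    (M : EuclideanSpace ℝ (Fin n) →L[ℝ] EuclideanSpace ℝ (Fin n)) : Prop :=
  ∃ Y : ℝ → EuclideanSpace ℝ (Fin n) →L[ℝ] EuclideanSpace ℝ (Fin n),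
    (∀ t, HasDerivAt Y ((A t).comp (Y t)) t) ∧
      Y 0 = ContinuousLinearMap.id ℝ (EuclideanSpace ℝ (Fin n)) ∧ Y T = M

/-- The cycle `x` is simple: the multiplier `+1` of the linearized system `y' = f'(x(t)) y`
has algebraic multiplicity one. -/
structure IsSimpleCycle {n : ℕ} (f : EuclideanSpace ℝ (Fin n) → EuclideanSpace ℝ (Fin n))
    (T : ℝ) (x : ℝ → EuclideanSpace ℝ (Fin n)) : Prop where
  isCycle : IsCycle f T x
  simple : ∃ M : EuclideanSpace ℝ (Fin n) →L[ℝ] EuclideanSpace ℝ (Fin n),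
    IsMonodromy (fun t => fderiv ℝ f (x t)) T M ∧
      (LinearMap.charpoly (M : EuclideanSpace ℝ (Fin n) →ₗ[ℝ] EuclideanSpace ℝ (Fin n))).rootMultiplicity
        1 = 1

/-- `z` solves the adjoint system `z' = -(f'(x(t)))* z` on the whole line. -/
def IsAdjointSolution {n : ℕ} (f : EuclideanSpace ℝ (Fin n) → EuclideanSpace ℝ (Fin n))
    (x z : ℝ → EuclideanSpace ℝ (Fin n)) : Prop :=
  ∀ t, HasDerivAt z (-(ContinuousLinearMap.adjoint (fderiv ℝ f (x t)) (z t))) t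

/-- The matrix `Z(t)` whose columns are the vectors `z₁(t), …, zₘ(t)`. -/
def colMatrix {n m : ℕ} (z : Fin m → ℝ → EuclideanSpace ℝ (Fin n)) (t : ℝ) :
    Matrix (Fin n) (Fin m) ℝ :=
  Matrix.of fun j i => z i t j

/-- `M^⊥(s) = ∫_{s-T}^{s} Z(τ)* g(τ, x(τ), 0) dτ`. -/
noncomputable def Mperp {n m : ℕ} (T : ℝ) (z : Fin m → ℝ → EuclideanSpace ℝ (Fin n))
    (g : ℝ → EuclideanSpace ℝ (Fin n) → ℝ → EuclideanSpace ℝ (Fin n))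
    (x : ℝ → EuclideanSpace ℝ (Fin n)) (s : ℝ) : Fin m → ℝ :=
  ∫ τ in (s - T)..s, (colMatrix z τ)ᵀ *ᵥ (g τ (x τ) 0).ofLp

/-- `S` is a smooth (`C¹`, injectively immersed) parametrized hypersurface which crosses the
curve `x` transversally at the point `x(θ) = S(0)`. -/
structure IsTransversalSurface {n : ℕ} (x : ℝ → EuclideanSpace ℝ (Fin n)) (θ : ℝ)
    (S : EuclideanSpace ℝ (Fin (n - 1)) → EuclideanSpace ℝ (Fin n)) : Prop where
  smooth : ContDiff ℝ 1 S
  injective : Function.Injective S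
  immersion : ∀ r, Function.Injective (fderiv ℝ S r)
  through : S 0 = x θ
  transversal : deriv x θ ∉ range (fderiv ℝ S 0)

/-! The pairing of an adjoint solution with a solution of the linearized equation is constant. Hence
each `z i t` stays orthogonal to the velocity `f (x t)`, and by independence and dimension the `z i
t` form a basis of the normal hyperplane. The surface at `θ` is the affine hyperplane `x θ + ∑ rᵢ
zᵢ(θ)`, and `Δ` is a small time shift that puts the perturbed solution `y` on it.

Translation by the period acts on the basis by a matrix: `Z*(θ - T) = C Z*(θ)`. A fixed vector of
`Cᵀ` would yield a nonzero `T`-periodic adjoint solution orthogonal to the velocity, which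
simplicity of the multiplier forbids (`IsSimpleCycle.adjoint_eq_zero`). So `1 - C` is invertible,
and `D = (1 - C)⁻¹`.

For fixed `Δ`, the deviation `u(t) = y(t - Δ) - x(t)` is `T`-periodic and satisfies the linearized
equation up to the defect `ε g(t, x(t), 0)` plus a small error. Integrating the derivative of `Z* u`
over one period gives `(1 - C) Z*(θ) u(θ) = ε M^⊥(θ) + error`.

The error is a small multiple of `‖u θ‖ + ε`, because Grönwall's inequality controls `u` on the
whole period by its value at the start. Since `u θ` is normal to the cycle, `‖u θ‖` is bounded by a
multiple of `‖Z*(θ) u(θ)‖`. Absorbing then gives `‖u θ‖ = O(ε)`, so the error is `o(ε)` uniformly in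
`θ`; see `IsCycle.exists_norm_pairing_sub_Mperp_le`. -/

/-! ### Grönwall, uniform Taylor and compactness estimates; simple eigenvalues -/

section GeneralLemmas

variable {E F : Type*} [NormedAddCommGroup E] [NormedSpace ℝ E]
  [NormedAddCommGroup F] [NormedSpace ℝ F]

/-- A Grönwall estimate that needs the differential inequality only inside the unit ball. -/
theorem norm_le_mul_exp_of_norm_deriv_le_in_ball {u u' : ℝ → E} {a b K η δ : ℝ}
    (hu : ∀ t, HasDerivAt u (u' t) t) (hK : 0 ≤ K)
    (hbound : ∀ t ∈ Icc a b, ‖u t‖ ≤ 1 → ‖u' t‖ ≤ K * ‖u t‖ + η)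
    (ha : ‖u a‖ ≤ δ) (hη : η < δ) (hδ : 0 ≤ δ) (hδ1 : δ * Real.exp ((K + 1) * (b - a)) ≤ 1) :
    ∀ t ∈ Icc a b, ‖u t‖ ≤ δ * Real.exp ((K + 1) * (t - a)) := by
  -- Where `‖u‖` meets the barrier it is at least `δ > η`, so the barrier's slope `(K + 1) ‖u‖`
  -- strictly exceeds `K ‖u‖ + η`. The barrier stays below 1, so the differential inequality is
  -- available there.
  refine image_norm_le_of_norm_deriv_right_lt_deriv_boundary
    (fun t _ => (hu t).continuousAt.continuousWithinAt)
    (fun t _ => (hu t).hasDerivWithinAt)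
    (B := fun t => δ * Real.exp ((K + 1) * (t - a)))
    (B' := fun t => δ * (Real.exp ((K + 1) * (t - a)) * ((K + 1) * 1))) (by simpa using ha)
    (fun t => ((((hasDerivAt_id t).sub_const a).const_mul (K + 1)).exp).const_mul δ) ?_
  intro t ht hBt
  have h1 : Real.exp ((K + 1) * (t - a)) ≤ Real.exp ((K + 1) * (b - a)) := by
    apply Real.exp_le_exp.2
    exact mul_le_mul_of_nonneg_left (by linarith [ht.2]) (by linarith)
  have h2 : 1 ≤ Real.exp ((K + 1) * (t - a)) :=
    Real.one_le_exp (mul_nonneg (by linarith) (by linarith [ht.1]))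
  have h3 : ‖u t‖ ≤ 1 := by
    rw [hBt]; exact (mul_le_mul_of_nonneg_left h1 hδ).trans hδ1
  have h4 := hbound t ⟨ht.1, ht.2.le⟩ h3
  have h5 : δ ≤ ‖u t‖ := by rw [hBt]; exact le_mul_of_one_le_right hδ h2
  have h6 : δ * (Real.exp ((K + 1) * (t - a)) * ((K + 1) * 1)) = (K + 1) * ‖u t‖ := by
    rw [hBt]; ring
  rw [h6]
  linarith

theorem eq_zero_of_hasDerivAt_linear {A : ℝ → E →L[ℝ] E} {K : ℝ} (hA : ∀ t, ‖A t‖ ≤ K)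
    {y : ℝ → E} (hy : ∀ t, HasDerivAt y (A t (y t)) t) {t₀ : ℝ} (h0 : y t₀ = 0) (t : ℝ) :
    y t = 0 := by
  have hK : 0 ≤ K := (norm_nonneg _).trans (hA 0)
  have := ODE_solution_unique_univ (v := fun t v => A t v) (s := fun _ => univ)
    (K := ⟨K, hK⟩) (f := y) (g := fun _ => 0) (t₀ := t₀)
    (fun t => ((A t).lipschitz.weaken (by exact_mod_cast hA t)).lipschitzOnWith)
    (fun t => ⟨hy t, trivial⟩)
    (fun t => ⟨by simpa using hasDerivAt_const t (0 : E), trivial⟩) h0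
  rw [this]

theorem ContDiff.exists_norm_sub_le_of_mem_closedBall [ProperSpace E] {f : E → F}
    (hf : ContDiff ℝ 1 f) (R : ℝ) :
    ∃ K, 0 ≤ K ∧ ∀ p ∈ Metric.closedBall (0 : E) R, ∀ q ∈ Metric.closedBall (0 : E) R,
      ‖f q - f p‖ ≤ K * ‖q - p‖ := by
  obtain ⟨K, hK⟩ := (isCompact_closedBall (0 : E) R).exists_bound_of_continuousOn
    (hf.continuous_fderiv one_ne_zero).continuousOn
  refine ⟨max K 0, le_max_right _ _, fun p hp q hq => ?_⟩
  exact (convex_closedBall (0 : E) R).norm_image_sub_le_of_norm_fderiv_le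
    (fun x _ => hf.differentiable one_ne_zero x)
    (fun x hx => (hK x hx).trans (le_max_left _ _)) hp hq

theorem ContDiff.exists_norm_sub_sub_fderiv_le [ProperSpace E] {f : E → F}
    (hf : ContDiff ℝ 1 f) (R : ℝ) {η : ℝ} (hη : 0 < η) :
    ∃ ρ, 0 < ρ ∧ ∀ p ∈ Metric.closedBall (0 : E) R, ∀ v : E, ‖v‖ ≤ ρ →
      ‖f (p + v) - f p - fderiv ℝ f p v‖ ≤ η * ‖v‖ := by
  have huc := (isCompact_closedBall (0 : E) (R + 1)).uniformContinuousOn_of_continuous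
    (hf.continuous_fderiv one_ne_zero).continuousOn
  obtain ⟨δ, hδ, h⟩ := Metric.uniformContinuousOn_iff.1 huc η hη
  refine ⟨min (δ / 2) 1, lt_min (by linarith) one_pos, fun p hp v hv => ?_⟩
  have hp' : ‖p‖ ≤ R := by simpa using hp
  have hv1 : ‖v‖ ≤ 1 := hv.trans (min_le_right _ _)
  have hv2 : ‖v‖ ≤ δ / 2 := hv.trans (min_le_left _ _)
  have := (convex_closedBall p ‖v‖).norm_image_sub_le_of_norm_fderiv_le'
    (f := f) (φ := fderiv ℝ f p) (C := η) (x := p) (y := p + v)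
    (fun x _ => hf.differentiable one_ne_zero x) ?_ (by simp) (by simp)
  · simpa using this
  · intro x hx
    have hx' : ‖x - p‖ ≤ ‖v‖ := by simpa [dist_eq_norm] using hx
    rw [← dist_eq_norm]
    refine (h x ?_ p ?_ ?_).le
    · have := norm_le_norm_add_norm_sub' x p
      simp only [mem_closedBall_zero_iff]; linarith
    · simp only [mem_closedBall_zero_iff]; linarith
    · rw [dist_eq_norm]; linarith

/-- A continuous family of injective linear maps is uniformly bounded below on a compact set. -/
theorem IsCompact.exists_norm_le_mul_norm_of_injective [FiniteDimensional ℝ E]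
    {K : Set ℝ} (hK : IsCompact K) {A : ℝ → E →L[ℝ] F}
    (hA : Continuous fun p : ℝ × E => A p.1 p.2)
    (hinj : ∀ t ∈ K, Function.Injective (A t)) :
    ∃ c, 0 < c ∧ ∀ t ∈ K, ∀ v, ‖v‖ ≤ c * ‖A t v‖ := by
  have hprop : ProperSpace E := FiniteDimensional.proper ℝ E
  obtain ⟨δ, hδ, h⟩ : ∃ δ, 0 < δ ∧ ∀ p ∈ K ×ˢ Metric.sphere (0 : E) 1, δ ≤ ‖A p.1 p.2‖ := by
    rcases (K ×ˢ Metric.sphere (0 : E) 1).eq_empty_or_nonempty with he | hne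
    · exact ⟨1, one_pos, by simp [he]⟩
    · obtain ⟨q, hq, hmin⟩ := (hK.prod (isCompact_sphere (0 : E) 1)).exists_isMinOn hne
        hA.norm.continuousOn
      refine ⟨‖A q.1 q.2‖, norm_pos_iff.2 fun h0 => ?_, fun p hp => hmin hp⟩
      have hq2 : q.2 = 0 := hinj q.1 hq.1 (by simpa using h0)
      have := hq.2
      simp [hq2] at this
  refine ⟨δ⁻¹, inv_pos.2 hδ, fun t ht v => ?_⟩
  rcases eq_or_ne v 0 with rfl | hv
  · simp
  have hv' : 0 < ‖v‖ := norm_pos_iff.2 hv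
  have := h (t, ‖v‖⁻¹ • v) ⟨ht, by simp [norm_smul, hv'.ne']⟩
  simp only [map_smul, norm_smul, norm_inv, norm_norm] at this
  rw [inv_mul_eq_div, le_div_iff₀ hδ]
  rwa [inv_mul_eq_div, le_div_iff₀ hv', mul_comm] at this

/-- If the multiplier `1` is simple with eigenvector `e`, then the linear functionals which are
invariant under `M` and vanish at `e` are zero. -/
theorem eq_zero_of_simple_eigenvalue [FiniteDimensional ℝ E] {M : E →ₗ[ℝ] E}
    (hM : M.charpoly.rootMultiplicity 1 = 1) {e : E} (he : e ≠ 0) (hMe : M e = e)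
    {φ : E →ₗ[ℝ] ℝ} (hφ : ∀ v, φ (M v) = φ v) (hφe : φ e = 0) : φ = 0 := by
  set N : E →ₗ[ℝ] E := M - 1 with hN
  have hfin : Module.finrank ℝ (Module.End.maxGenEigenspace M 1) = 1 := by
    rw [LinearMap.finrank_maxGenEigenspace_eq, hM]
  have hmem : ∀ (k : ℕ) v, (N ^ k) v = 0 → v ∈ Module.End.maxGenEigenspace M 1 := fun k v hv =>
    Module.End.mem_maxGenEigenspace M 1 v |>.2 ⟨k, by simpa [hN] using hv⟩
  have heN : N e = 0 := by simp [hN, hMe]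
  have hspan : ∀ v ∈ Module.End.maxGenEigenspace M 1, ∃ c : ℝ, c • e = v := by
    intro v hv
    have he' : (⟨e, hmem 1 e (by simpa using heN)⟩ : Module.End.maxGenEigenspace M 1) ≠ 0 := by
      simpa [Subtype.ext_iff] using he
    obtain ⟨c, hc⟩ := (finrank_eq_one_iff_of_nonzero' _ he').1 hfin ⟨v, hv⟩
    exact ⟨c, by simpa [Subtype.ext_iff] using hc⟩
  -- If `φ ≠ 0`, the inclusion of `range N` in `ker φ` is an equality by dimension. Then `e = N w`
  -- with `w` in the generalized eigenspace, which is the line of `e`, so `N w = 0`.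
  by_contra hφ0
  have hker : LinearMap.ker N = Submodule.span ℝ {e} := by
    apply le_antisymm
    · intro v hv
      exact Submodule.mem_span_singleton.2 (hspan v (hmem 1 v (by simpa using hv)))
    · rw [Submodule.span_singleton_le_iff_mem]; exact heN
  have hrange : LinearMap.range N = LinearMap.ker φ := by
    apply Submodule.eq_of_le_of_finrank_eq
    · rintro _ ⟨v, rfl⟩
      simp [hN, hφ]
    · have h1 := LinearMap.finrank_range_add_finrank_ker N
      have h2 := LinearMap.finrank_range_add_finrank_ker φ
      rw [hker, finrank_span_singleton he] at h1
      have h3 : LinearMap.range φ = ⊤ := LinearMap.range_eq_top.2 (LinearMap.surjective hφ0)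
      rw [h3, finrank_top, Module.finrank_self] at h2
      omega
  obtain ⟨w, hw⟩ : e ∈ LinearMap.range N := by rw [hrange]; exact hφe
  obtain ⟨c, hc⟩ := hspan w (hmem 2 w (by simp [pow_two, hw, heN]))
  apply he
  rw [← hw, ← hc, map_smul, heN, smul_zero]

end GeneralLemmas

/-! ### Floquet theory of the adjoint system along the cycle -/

section LinearTheory

variable {n : ℕ} {f : EuclideanSpace ℝ (Fin n) → EuclideanSpace ℝ (Fin n)} {T : ℝ}
  {x : ℝ → EuclideanSpace ℝ (Fin n)}

theorem IsCycle.continuous (hx : IsCycle f T x) : Continuous x :=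
  continuous_iff_continuousAt.2 fun t => (hx.isSolution t).continuousAt

theorem IsCycle.deriv_eq (hx : IsCycle f T x) (t : ℝ) : deriv x t = f (x t) :=
  (hx.isSolution t).deriv

/-- A continuous periodic function is bounded. -/
theorem Function.Periodic.exists_norm_le {F : Type*} [SeminormedAddCommGroup F] {T : ℝ}
    {φ : ℝ → F} (hφ : Function.Periodic φ T) (hT : 0 < T) (hc : Continuous φ) :
    ∃ R, ∀ t, ‖φ t‖ ≤ R := by
  obtain ⟨R, hR⟩ := (isCompact_Icc (a := (0 : ℝ)) (b := T)).exists_bound_of_continuousOn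
    hc.continuousOn
  refine ⟨R, fun t => ?_⟩
  obtain ⟨s, hs, hst⟩ := hφ.exists_mem_Ico₀ hT t
  rw [hst]
  exact hR s ⟨hs.1, hs.2.le⟩

theorem IsCycle.exists_norm_le (hx : IsCycle f T x) : ∃ R, ∀ t, ‖x t‖ ≤ R :=
  hx.periodic.exists_norm_le hx.period_pos hx.continuous

theorem IsCycle.exists_norm_fderiv_le (hf : ContDiff ℝ 1 f) (hx : IsCycle f T x) :
    ∃ K, ∀ t, ‖fderiv ℝ f (x t)‖ ≤ K :=
  (hx.periodic.comp (fderiv ℝ f)).exists_norm_le hx.period_pos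
    ((hf.continuous_fderiv one_ne_zero).comp hx.continuous)

theorem IsCycle.hasDerivAt_velocity (hf : ContDiff ℝ 1 f) (hx : IsCycle f T x) (t : ℝ) :
    HasDerivAt (fun t => f (x t)) (fderiv ℝ f (x t) (f (x t))) t :=
  ((hf.differentiable one_ne_zero (x t)).hasFDerivAt).comp_hasDerivAt t (hx.isSolution t)

/-- The velocity solves the linearized equation, so a single zero would make it vanish identically
and the cycle would be constant. -/
theorem IsCycle.velocity_ne_zero (hf : ContDiff ℝ 1 f) (hx : IsCycle f T x) (t : ℝ) :
    f (x t) ≠ 0 := by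
  intro h0
  obtain ⟨K, hK⟩ := hx.exists_norm_fderiv_le hf
  have hz := eq_zero_of_hasDerivAt_linear hK (hx.hasDerivAt_velocity hf) h0
  obtain ⟨s, r, hsr⟩ := hx.nonconstant
  refine hsr (is_const_of_deriv_eq_zero (fun t => (hx.isSolution t).differentiableAt)
    (fun t => ?_) s r)
  rw [hx.deriv_eq, hz]

theorem IsCycle.adjoint_eq_zero (hf : ContDiff ℝ 1 f) (hx : IsCycle f T x)
    {z : ℝ → EuclideanSpace ℝ (Fin n)} (hz : IsAdjointSolution f x z) {t₀ : ℝ} (h0 : z t₀ = 0)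
    (t : ℝ) : z t = 0 := by
  obtain ⟨K, hK⟩ := hx.exists_norm_fderiv_le hf
  refine eq_zero_of_hasDerivAt_linear (K := K)
    (A := fun t => -ContinuousLinearMap.adjoint (fderiv ℝ f (x t))) (fun t => ?_) hz h0 t
  rw [norm_neg, LinearIsometryEquiv.norm_map]
  exact hK t

theorem IsAdjointSolution.continuous {z : ℝ → EuclideanSpace ℝ (Fin n)}
    (hz : IsAdjointSolution f x z) : Continuous z :=
  continuous_iff_continuousAt.2 fun t => (hz t).continuousAt

theorem IsAdjointSolution.contDiff (hf : ContDiff ℝ 1 f) (hx : Continuous x)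
    {z : ℝ → EuclideanSpace ℝ (Fin n)} (hz : IsAdjointSolution f x z) : ContDiff ℝ 1 z := by
  refine contDiff_one_iff_deriv.2 ⟨fun t => (hz t).differentiableAt, ?_⟩
  have : deriv z = fun t => -(ContinuousLinearMap.adjoint (fderiv ℝ f (x t)) (z t)) :=
    funext fun t => (hz t).deriv
  rw [this]
  have h1 : Continuous fun t => ContinuousLinearMap.adjoint (fderiv ℝ f (x t)) :=
    ContinuousLinearMap.adjoint.continuous.comp
      ((hf.continuous_fderiv one_ne_zero).comp hx)
  exact (h1.clm_apply hz.continuous).neg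

/-- The pairing of an adjoint solution with an arbitrary curve only sees the defect of the curve
with respect to the linearized equation. -/
theorem IsAdjointSolution.hasDerivAt_inner {z : ℝ → EuclideanSpace ℝ (Fin n)}
    (hz : IsAdjointSolution f x z) {y : ℝ → EuclideanSpace ℝ (Fin n)}
    {y' : EuclideanSpace ℝ (Fin n)} {t : ℝ} (hy : HasDerivAt y y' t) :
    HasDerivAt (fun t => inner ℝ (z t) (y t)) (inner ℝ (z t) (y' - fderiv ℝ f (x t) (y t))) t := by
  convert! (hz t).inner ℝ hy using 1
  rw [inner_neg_left, ContinuousLinearMap.adjoint_inner_left, inner_sub_right]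
  ring

theorem IsAdjointSolution.inner_eq {z : ℝ → EuclideanSpace ℝ (Fin n)}
    (hz : IsAdjointSolution f x z) {y : ℝ → EuclideanSpace ℝ (Fin n)}
    (hy : ∀ t, HasDerivAt y (fderiv ℝ f (x t) (y t)) t) (s t : ℝ) :
    inner ℝ (z s) (y s) = inner ℝ (z t) (y t) := by
  have h := fun t => hz.hasDerivAt_inner (hy t)
  exact is_const_of_deriv_eq_zero (fun t => (h t).differentiableAt)
    (fun t => by rw [(h t).deriv, sub_self, inner_zero_right]) s t

theorem IsAdjointSolution.sum {ι : Type*} [Fintype ι] {z : ι → ℝ → EuclideanSpace ℝ (Fin n)}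
    (hz : ∀ i, IsAdjointSolution f x (z i)) (c : ι → ℝ) :
    IsAdjointSolution f x fun t => ∑ i, c i • z i t := by
  intro t
  have := HasDerivAt.fun_sum (u := Finset.univ) fun i _ => (hz i t).const_smul (c i)
  convert! this using 1
  simp [map_sum]

theorem IsAdjointSolution.sub {z w : ℝ → EuclideanSpace ℝ (Fin n)}
    (hz : IsAdjointSolution f x z) (hw : IsAdjointSolution f x w) :
    IsAdjointSolution f x fun t => z t - w t := by
  intro t
  convert! (hz t).sub (hw t) using 1
  rw [map_sub]; abel

theorem IsAdjointSolution.shift (hper : Function.Periodic x T)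
    {z : ℝ → EuclideanSpace ℝ (Fin n)} (hz : IsAdjointSolution f x z) :
    IsAdjointSolution f x fun t => z (t - T) := by
  intro t
  have h := (hz (t - T)).comp_sub_const t T
  rwa [hper.sub_eq] at h

/-- A periodic adjoint solution orthogonal to the velocity of a simple cycle is zero. -/
theorem IsSimpleCycle.adjoint_eq_zero (hf : ContDiff ℝ 1 f) (hx : IsSimpleCycle f T x)
    {z : ℝ → EuclideanSpace ℝ (Fin n)} (hz : IsAdjointSolution f x z) (hzT : z T = z 0)
    (horth : inner ℝ (z 0) (f (x 0)) = 0) : z 0 = 0 := by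
  obtain ⟨M, ⟨Y, hY, hY0, rfl⟩, hM⟩ := hx.simple
  obtain ⟨K, hK⟩ := hx.isCycle.exists_norm_fderiv_le hf
  have hYv : ∀ v t, HasDerivAt (fun t => Y t v) (fderiv ℝ f (x t) (Y t v)) t := fun v t => by
    simpa using (hY t).clm_apply (hasDerivAt_const t v)
  have he : Y T (f (x 0)) = f (x 0) := by
    have h0 := eq_zero_of_hasDerivAt_linear (y := fun t => Y t (f (x 0)) - f (x t)) hK (fun t => by
      simp only [map_sub]
      exact (hYv _ t).sub (hx.isCycle.hasDerivAt_velocity hf t)) (t₀ := 0)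
      (by simp [hY0]) T
    have hT : x T = x 0 := by simpa using hx.isCycle.periodic 0
    rw [hT] at h0
    exact sub_eq_zero.1 h0
  -- The functional `⟨z 0, ·⟩` is invariant under `Y T`, since `⟨z t, Y t v⟩` is constant in `t` and
  -- `z T = z 0`.
  have hφ := eq_zero_of_simple_eigenvalue hM (hx.isCycle.velocity_ne_zero hf 0) he
    (φ := (innerSL ℝ (z 0) : EuclideanSpace ℝ (Fin n) →ₗ[ℝ] ℝ)) (fun v => by
      have := hz.inner_eq (hYv v) T 0
      simpa [hzT, hY0] using this) (by simpa using horth)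
  have := LinearMap.congr_fun hφ (z 0)
  simpa using this

variable {z : Fin (n - 1) → ℝ → EuclideanSpace ℝ (Fin n)}

theorem IsCycle.inner_velocity_eq_zero (hf : ContDiff ℝ 1 f) (hx : IsCycle f T x)
    {z : ℝ → EuclideanSpace ℝ (Fin n)} (hz : IsAdjointSolution f x z)
    (horth : inner ℝ (deriv x 0) (z 0) = 0) (t : ℝ) : inner ℝ (z t) (f (x t)) = 0 := by
  rw [hz.inner_eq (hx.hasDerivAt_velocity hf) t 0, real_inner_comm, ← hx.deriv_eq]
  exact horth

/-- By uniqueness, a combination of adjoint solutions that vanishes at one time vanishes at all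
times. -/
theorem IsCycle.linearIndependent_apply (hf : ContDiff ℝ 1 f) (hx : IsCycle f T x)
    (hz : ∀ i, IsAdjointSolution f x (z i)) (hind : LinearIndependent ℝ z) (t : ℝ) :
    LinearIndependent ℝ fun i => z i t := by
  rw [Fintype.linearIndependent_iff] at hind ⊢
  intro c hc
  refine hind c (funext fun s => ?_)
  have := hx.adjoint_eq_zero hf (IsAdjointSolution.sum hz c) hc s
  simpa using this

theorem IsCycle.span_eq_orthogonal (hf : ContDiff ℝ 1 f) (hx : IsCycle f T x)
    (hz : ∀ i, IsAdjointSolution f x (z i)) (hind : LinearIndependent ℝ z)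
    (horth : ∀ i, inner ℝ (deriv x 0) (z i 0) = 0) (t : ℝ) :
    Submodule.span ℝ (range fun i => z i t) = (Submodule.span ℝ {f (x t)})ᗮ := by
  apply Submodule.eq_of_le_of_finrank_eq
  · rw [Submodule.span_le]
    rintro _ ⟨i, rfl⟩
    rw [SetLike.mem_coe, Submodule.mem_orthogonal_singleton_iff_inner_left]
    exact hx.inner_velocity_eq_zero hf (hz i) (horth i) t
  · rw [finrank_span_eq_card (hx.linearIndependent_apply hf hz hind t)]
    have := (Submodule.span ℝ {f (x t)}).finrank_add_finrank_orthogonal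
    rw [finrank_span_singleton (hx.velocity_ne_zero hf t), finrank_euclideanSpace_fin] at this
    rw [Fintype.card_fin]
    omega

/-- The translation by a period acts on the adjoint solutions `z` by a matrix `C` which does not
have the eigenvalue `1`. -/
theorem IsSimpleCycle.exists_translation_matrix (hf : ContDiff ℝ 1 f) (hx : IsSimpleCycle f T x)
    (hz : ∀ i, IsAdjointSolution f x (z i)) (hind : LinearIndependent ℝ z)
    (horth : ∀ i, inner ℝ (deriv x 0) (z i 0) = 0) :
    ∃ C : Matrix (Fin (n - 1)) (Fin (n - 1)) ℝ, IsUnit (1 - C).det ∧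
      ∀ i t, z i (t - T) = ∑ j, C i j • z j t := by
  have hxc := hx.isCycle
  have hper : x (0 - T) = x 0 := hxc.periodic.sub_eq 0
  have hmem : ∀ i, ∃ c : Fin (n - 1) → ℝ, ∑ j, c j • z j 0 = z i (0 - T) := by
    intro i
    rw [← Submodule.mem_span_range_iff_exists_fun, hxc.span_eq_orthogonal hf hz hind horth,
      Submodule.mem_orthogonal_singleton_iff_inner_left, ← hper]
    exact hxc.inner_velocity_eq_zero hf (hz i) (horth i) _
  choose c hc using hmem
  have hC : ∀ i t, z i (t - T) = ∑ j, c i j • z j t := fun i t => sub_eq_zero.1 <|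
    hxc.adjoint_eq_zero hf (((hz i).shift hxc.periodic).sub (IsAdjointSolution.sum hz (c i)))
      (sub_eq_zero.2 (hc i).symm) t
  refine ⟨Matrix.of c, ?_, hC⟩
  rw [isUnit_iff_ne_zero, ← Matrix.det_transpose]
  intro hdet
  -- A kernel vector `a` of `(1 - C)ᵀ` makes `∑ aᵢ zᵢ` take equal values at `0` and `T`.
  obtain ⟨a, ha, hker⟩ := Matrix.exists_mulVec_eq_zero_iff.2 hdet
  have hy := IsAdjointSolution.sum hz a
  have hCa : ∀ j, ∑ i, a i * c i j = a j := by
    intro j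
    have := congrFun hker j
    simp only [transpose_sub, transpose_one, sub_mulVec, one_mulVec, Pi.sub_apply,
      Pi.zero_apply, sub_eq_zero] at this
    rw [this]
    simp [mulVec, dotProduct, mul_comm]
  have hyT : ∑ i, a i • z i 0 = ∑ i, a i • z i T := by
    have : ∑ i, a i • z i (T - T) = ∑ j, a j • z j T := by
      simp_rw [hC, Finset.smul_sum, smul_smul]
      rw [Finset.sum_comm]
      simp_rw [← Finset.sum_smul, hCa]
    simpa using this
  have h0 := hx.adjoint_eq_zero hf hy hyT.symm (by
    simp [sum_inner, inner_smul_left, hxc.inner_velocity_eq_zero hf (hz _) (horth _)])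
  have := Fintype.linearIndependent_iff.1 (hxc.linearIndependent_apply hf hz hind 0) a h0
  exact ha (funext this)

/-- The linear map `v ↦ (⟨z₁(t), v⟩, …, ⟨zₘ(t), v⟩)`. -/
noncomputable def pairing {m : ℕ} (z : Fin m → ℝ → EuclideanSpace ℝ (Fin n)) (t : ℝ) :
    EuclideanSpace ℝ (Fin n) →L[ℝ] (Fin m → ℝ) :=
  ContinuousLinearMap.pi fun i => innerSL ℝ (z i t)

theorem pairing_apply {m : ℕ} (z : Fin m → ℝ → EuclideanSpace ℝ (Fin n)) (t : ℝ)
    (v : EuclideanSpace ℝ (Fin n)) (i : Fin m) : pairing z t v i = inner ℝ (z i t) v := rfl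

theorem colMatrix_transpose_mulVec {m : ℕ} (z : Fin m → ℝ → EuclideanSpace ℝ (Fin n)) (t : ℝ)
    (v : EuclideanSpace ℝ (Fin n)) : (colMatrix z t)ᵀ *ᵥ v.ofLp = pairing z t v := by
  ext i
  simp [pairing_apply, colMatrix, mulVec, dotProduct, PiLp.inner_apply, mul_comm]

theorem continuous_pairing {m : ℕ} {z : Fin m → ℝ → EuclideanSpace ℝ (Fin n)}
    (hz : ∀ i, Continuous (z i)) :
    Continuous fun p : ℝ × EuclideanSpace ℝ (Fin n) => pairing z p.1 p.2 :=
  continuous_pi fun i => ((hz i).comp continuous_fst).inner continuous_snd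

/-- The pairing sees everything except the velocity direction. Adjoining the pairing with the
velocity makes it injective, and compactness of a period gives a uniform constant. -/
theorem IsCycle.exists_norm_le_mul_norm_pairing (hf : ContDiff ℝ 1 f) (hx : IsCycle f T x)
    (hz : ∀ i, IsAdjointSolution f x (z i)) (hind : LinearIndependent ℝ z)
    (horth : ∀ i, inner ℝ (deriv x 0) (z i 0) = 0) :
    ∃ c, 0 < c ∧ ∀ t ∈ Icc 0 T, ∀ v, inner ℝ (f (x t)) v = 0 → ‖v‖ ≤ c * ‖pairing z t v‖ := by
  obtain ⟨c, hc, h⟩ := (isCompact_Icc (a := 0) (b := T)).exists_norm_le_mul_norm_of_injective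
    (A := fun t => (pairing z t).prod (innerSL ℝ (f (x t)))) (by
      refine (continuous_pairing fun i => (hz i).continuous).prodMk ?_
      exact ((hf.continuous.comp hx.continuous).comp continuous_fst).inner continuous_snd) (by
      intro t _
      rw [injective_iff_map_eq_zero]
      intro v hv
      rw [ContinuousLinearMap.prod_apply, Prod.mk_eq_zero] at hv
      have hv1 : v ∈ (Submodule.span ℝ {f (x t)})ᗮ :=
        Submodule.mem_orthogonal_singleton_iff_inner_right.2 hv.2
      rw [← hx.span_eq_orthogonal hf hz hind horth] at hv1
      have hv2 : ∀ w ∈ Submodule.span ℝ (range fun i => z i t), inner ℝ w v = 0 := by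
        intro w hw
        induction hw using Submodule.span_induction with
        | mem w hw => obtain ⟨i, rfl⟩ := hw; exact congrFun hv.1 i
        | zero => simp
        | add a b _ _ ha hb => rw [inner_add_left, ha, hb, add_zero]
        | smul a b _ hb => rw [inner_smul_left, hb, mul_zero]
      exact inner_self_eq_zero.1 (hv2 v hv1))
  refine ⟨c, hc, fun t ht v hv => ?_⟩
  have := h t ht v
  rwa [ContinuousLinearMap.prod_apply, innerSL_apply_apply, hv, Prod.norm_mk, norm_zero,
    max_eq_left (norm_nonneg _)] at this

end LinearTheory

/-! ### Perturbed solutions near the cycle -/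

section Perturbation

variable {n : ℕ} {f : EuclideanSpace ℝ (Fin n) → EuclideanSpace ℝ (Fin n)} {T : ℝ}
  {x : ℝ → EuclideanSpace ℝ (Fin n)}
  {g : ℝ → EuclideanSpace ℝ (Fin n) → ℝ → EuclideanSpace ℝ (Fin n)}

theorem exists_norm_perturbation_le
    (hg : ContinuousOn (fun p : ℝ × EuclideanSpace ℝ (Fin n) × ℝ => g p.1 p.2.1 p.2.2)
      {p | p.2.2 ∈ Icc 0 1}) (a b R : ℝ) :
    ∃ G, 0 ≤ G ∧ ∀ t ∈ Icc a b, ∀ p, ‖p‖ ≤ R → ∀ ε ∈ Icc (0 : ℝ) 1, ‖g t p ε‖ ≤ G := by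
  obtain ⟨G, hG⟩ := ((isCompact_Icc (a := a) (b := b)).prod
    ((isCompact_closedBall (0 : EuclideanSpace ℝ (Fin n)) R).prod
      (isCompact_Icc (a := (0 : ℝ)) (b := 1)))).exists_bound_of_continuousOn
    (hg.mono fun p hp => hp.2.2)
  exact ⟨max G 0, le_max_right _ _, fun t ht p hp ε hε =>
    (hG (t, p, ε) ⟨ht, by simpa using hp, hε⟩).trans (le_max_left _ _)⟩

/-- The time arguments differ because along a shifted solution `g` is evaluated at `t - Δ`, while
`M^⊥` uses time `t`. -/
theorem exists_norm_perturbation_sub_le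
    (hg : ContinuousOn (fun p : ℝ × EuclideanSpace ℝ (Fin n) × ℝ => g p.1 p.2.1 p.2.2)
      {p | p.2.2 ∈ Icc 0 1}) (a b R : ℝ) {η : ℝ} (hη : 0 < η) :
    ∃ ρ, 0 < ρ ∧ ∀ s ∈ Icc a b, ∀ t ∈ Icc a b, ∀ p q, ‖p‖ ≤ R → ‖q‖ ≤ R →
      ∀ ε ∈ Icc (0 : ℝ) 1, |s - t| ≤ ρ → ‖p - q‖ ≤ ρ → ε ≤ ρ → ‖g s p ε - g t q 0‖ ≤ η := by
  have huc := ((isCompact_Icc (a := a) (b := b)).prod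
    ((isCompact_closedBall (0 : EuclideanSpace ℝ (Fin n)) R).prod
      (isCompact_Icc (a := (0 : ℝ)) (b := 1)))).uniformContinuousOn_of_continuous
    (hg.mono fun p hp => hp.2.2)
  obtain ⟨δ, hδ, h⟩ := Metric.uniformContinuousOn_iff.1 huc η hη
  refine ⟨δ / 2, by linarith, fun s hs t ht p q hp hq ε hε hst hpq hε' => ?_⟩
  rw [← dist_eq_norm]
  refine (h (s, p, ε) ⟨hs, by simpa using hp, hε⟩ (t, q, 0)
    ⟨ht, by simpa using hq, by simp⟩ ?_).le
  rw [Prod.dist_eq, Prod.dist_eq]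
  refine max_lt ?_ (max_lt ?_ ?_)
  · rw [Real.dist_eq]; linarith
  · rw [dist_eq_norm]; linarith
  · rw [Real.dist_eq, sub_zero, abs_of_nonneg hε.1]; linarith

theorem IsCycle.hasDerivAt_shift_sub (hx : IsCycle f T x) {ε : ℝ}
    {y : ℝ → EuclideanSpace ℝ (Fin n)}
    (hy : ∀ t, HasDerivAt y (f (y t) + ε • g t (y t) ε) t) (Δ t : ℝ) :
    HasDerivAt (fun t => y (t - Δ) - x t)
      (f (y (t - Δ)) + ε • g (t - Δ) (y (t - Δ)) ε - f (x t)) t :=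
  ((hy (t - Δ)).comp_sub_const t Δ).sub (hx.isSolution t)

/-- Continuous dependence: over one period a time translate of a perturbed solution stays close to
the cycle, linearly in the initial deviation and in the size of the perturbation. -/
theorem IsCycle.exists_norm_shift_sub_le (hf : ContDiff ℝ 1 f) (hx : IsCycle f T x)
    (hg : ContinuousOn (fun p : ℝ × EuclideanSpace ℝ (Fin n) × ℝ => g p.1 p.2.1 p.2.2)
      {p | p.2.2 ∈ Icc 0 1}) :
    ∃ κ r, 0 < κ ∧ 0 < r ∧ ∀ ε ∈ Ioc (0 : ℝ) 1, ∀ y : ℝ → EuclideanSpace ℝ (Fin n),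
      (∀ t, HasDerivAt y (f (y t) + ε • g t (y t) ε) t) → ∀ Δ, |Δ| ≤ 1 → ∀ a ∈ Icc (-T) 0,
      ‖y (a - Δ) - x a‖ + ε ≤ r →
      ∀ t ∈ Icc a (a + T), ‖y (t - Δ) - x t‖ ≤ κ * (‖y (a - Δ) - x a‖ + ε) := by
  obtain ⟨R, hR⟩ := hx.exists_norm_le
  obtain ⟨K, hK, hlip⟩ := hf.exists_norm_sub_le_of_mem_closedBall (R + 1)
  obtain ⟨G, hG, hgG⟩ := exists_norm_perturbation_le hg (-(T + 1)) (T + 1) (R + 1)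
  set e := Real.exp ((K + 1) * T) with he
  have he0 : 0 < e := Real.exp_pos _
  have hκ : 0 < (G + 1) * e := by positivity
  -- The factor `G + 1`, rather than `G`, makes the initial barrier `(G + 1) * (‖u a‖ + ε)` strictly
  -- larger than `ε * G` and at least `‖u a‖`. The radius `κ⁻¹` keeps the barrier within the unit
  -- ball.
  refine ⟨(G + 1) * e, ((G + 1) * e)⁻¹, hκ, inv_pos.2 hκ, ?_⟩
  intro ε hε y hy Δ hΔ a ha hsmall t ht
  set u := fun t => y (t - Δ) - x t with hu
  change ‖u t‖ ≤ _ * (‖u a‖ + ε)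
  change ‖u a‖ + ε ≤ _ at hsmall
  have hua := norm_nonneg (u a)
  have hΔ' := abs_le.1 hΔ
  have hδ : 0 ≤ (G + 1) * (‖u a‖ + ε) := by have := hε.1; positivity
  have key := norm_le_mul_exp_of_norm_deriv_le_in_ball (u := u) (a := a) (b := a + T) (K := K)
    (η := ε * G) (δ := (G + 1) * (‖u a‖ + ε)) (hx.hasDerivAt_shift_sub hy Δ) hK ?_ ?_ ?_ hδ ?_ t ht
  · refine key.trans ?_
    have : Real.exp ((K + 1) * (t - a)) ≤ e := by
      apply Real.exp_le_exp.2
      exact mul_le_mul_of_nonneg_left (by linarith [ht.2]) (by linarith)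
    calc _ ≤ (G + 1) * (‖u a‖ + ε) * e := mul_le_mul_of_nonneg_left this hδ
      _ = _ := by ring
  · intro s hs hus
    have hys : y (s - Δ) = x s + u s := by simp [hu]
    have hyn : ‖y (s - Δ)‖ ≤ R + 1 := by
      rw [hys]; exact (norm_add_le _ _).trans (add_le_add (hR s) hus)
    have h1 := hlip (x s) (by simpa using (hR s).trans (by linarith)) (y (s - Δ)) (by simpa using hyn)
    have h2 := hgG (s - Δ) ⟨by linarith [ha.1, hs.1], by linarith [ha.2, hs.2]⟩ (y (s - Δ)) hyn ε
      ⟨hε.1.le, hε.2⟩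
    calc ‖f (y (s - Δ)) + ε • g (s - Δ) (y (s - Δ)) ε - f (x s)‖
        = ‖(f (y (s - Δ)) - f (x s)) + ε • g (s - Δ) (y (s - Δ)) ε‖ := by congr 1; abel
      _ ≤ ‖f (y (s - Δ)) - f (x s)‖ + ε * ‖g (s - Δ) (y (s - Δ)) ε‖ := by
        refine (norm_add_le _ _).trans_eq ?_
        rw [norm_smul, Real.norm_of_nonneg hε.1.le]
      _ ≤ K * ‖u s‖ + ε * G := add_le_add h1 (mul_le_mul_of_nonneg_left h2 hε.1.le)
  · nlinarith [hε.1]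
  · nlinarith [hε.1]
  · have h3 := mul_le_mul_of_nonneg_left hsmall hκ.le
    rw [mul_inv_cancel₀ hκ.ne'] at h3
    calc _ = (G + 1) * e * (‖u a‖ + ε) := by rw [he, add_sub_cancel_left]; ring
      _ ≤ 1 := h3

/-- Pointwise convergence of periodic solutions of the perturbed equations to the cycle is
uniform. -/
theorem IsCycle.eventually_norm_sub_le (hf : ContDiff ℝ 1 f) (hx : IsCycle f T x)
    (hg : ContinuousOn (fun p : ℝ × EuclideanSpace ℝ (Fin n) × ℝ => g p.1 p.2.1 p.2.2)
      {p | p.2.2 ∈ Icc 0 1})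
    {ε : ℕ → ℝ} {y : ℕ → ℝ → EuclideanSpace ℝ (Fin n)} (hε : ∀ k, ε k ∈ Ioc 0 1)
    (hε0 : Tendsto ε atTop (𝓝 0))
    (hy : ∀ k t, HasDerivAt (y k) (f (y k t) + ε k • g t (y k t) (ε k)) t)
    (hper : ∀ k, Function.Periodic (y k) T)
    (hlim : Tendsto (fun k => y k 0) atTop (𝓝 (x 0))) {ρ : ℝ} (hρ : 0 < ρ) :
    ∀ᶠ k in atTop, ∀ t, ‖y k t - x t‖ ≤ ρ := by
  obtain ⟨κ, r, hκ, hr, h⟩ := hx.exists_norm_shift_sub_le hf hg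
  have h0 : Tendsto (fun k => ‖y k 0 - x 0‖ + ε k) atTop (𝓝 0) := by
    simpa using (tendsto_iff_norm_sub_tendsto_zero.1 hlim).add hε0
  filter_upwards [h0.eventually_le_const (lt_min hr (div_pos hρ hκ))] with k hk t
  -- Periodicity reduces all times to one period, where closeness at time `0` alone suffices.
  obtain ⟨s, hs, hst⟩ := ((hper k).sub hx.periodic).exists_mem_Ico₀ hx.period_pos t
  simp only [Pi.sub_apply] at hst
  rw [hst]
  have hT := hx.period_pos
  have := h (ε k) (hε k) (y k) (hy k) 0 (by simp) 0 ⟨by linarith, le_rfl⟩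
    (by simpa using hk.trans (min_le_left _ _)) s ⟨hs.1, by linarith [hs.2]⟩
  simp only [sub_zero] at this
  refine this.trans ?_
  have h2 := hk.trans (min_le_right _ _)
  rw [le_div_iff₀ hκ] at h2
  linarith

/-- A closed curve close to the cycle meets each normal hyperplane of the cycle at a time close to
that of the cycle. -/
theorem IsCycle.exists_shift_orthogonal (hf : ContDiff ℝ 1 f) (hx : IsCycle f T x) {ρ : ℝ}
    (hρ : 0 < ρ) :
    ∃ σ, 0 < σ ∧ ∀ y : ℝ → EuclideanSpace ℝ (Fin n), Continuous y →
      (∀ t, ‖y t - x t‖ ≤ σ) → ∀ θ ∈ Icc 0 T,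
      ∃ Δ, |Δ| ≤ ρ ∧ inner ℝ (f (x θ)) (y (θ - Δ) - x θ) = 0 := by
  have hvel : Continuous fun t => f (x t) := hf.continuous.comp hx.continuous
  obtain ⟨c, hc, hlow⟩ := (isCompact_Icc (a := 0) (b := T)).exists_norm_le_mul_norm_of_injective
    (A := fun t => ContinuousLinearMap.toSpanSingleton ℝ (f (x t)))
    (continuous_snd.smul (hvel.comp continuous_fst)) (fun t _ a b hab =>
      smul_left_injective ℝ (hx.velocity_ne_zero hf t) hab)
  have hx1 : ContDiff ℝ 1 x := contDiff_one_iff_deriv.2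
    ⟨fun t => (hx.isSolution t).differentiableAt, by rw [funext hx.deriv_eq]; exact hvel⟩
  obtain ⟨ρ₀, hρ₀, htay⟩ := hx1.exists_norm_sub_sub_fderiv_le T
    (η := 1 / (2 * c)) (by positivity)
  set s := min ρ ρ₀ with hs
  have hs0 : 0 < s := lt_min hρ hρ₀
  -- At times `θ ± s`, the closeness of `y` and the Taylor remainder of `x` each contribute at most
  -- `s / (2 * c)`, in total at most `s * ‖v‖`. The main term `± s * ‖v‖ ^ 2` therefore fixes the
  -- signs needed for the intermediate value theorem.
  refine ⟨s / (2 * c), by positivity, fun y hy hyx θ hθ => ?_⟩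
  set v := f (x θ) with hv
  have hv1 : 1 ≤ c * ‖v‖ := by
    have := hlow θ hθ 1
    simpa using this
  have hψ : Continuous fun Δ => inner ℝ v (y (θ - Δ) - x θ) :=
    continuous_const.inner ((hy.comp (continuous_const.sub continuous_id)).sub continuous_const)
  have hest : ∀ w, |w| = s → ‖y (θ + w) - x θ - w • v‖ ≤ s * ‖v‖ := by
    intro w hw
    have h1 := htay θ (by simpa [abs_of_nonneg hθ.1] using hθ.2) w
      (by rw [Real.norm_eq_abs, hw]; exact min_le_right _ _)
    have h2 : fderiv ℝ x θ w = w • v := by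
      rw [(hx.isSolution θ).hasFDerivAt.fderiv]; simp [hv]
    rw [h2, Real.norm_eq_abs, hw] at h1
    calc ‖y (θ + w) - x θ - w • v‖
        = ‖(y (θ + w) - x (θ + w)) + (x (θ + w) - x θ - w • v)‖ := by congr 1; abel
      _ ≤ s / (2 * c) + 1 / (2 * c) * s := (norm_add_le _ _).trans (add_le_add (hyx _) h1)
      _ = s * (1 / c) := by field_simp; ring
      _ ≤ s * ‖v‖ := by
        refine mul_le_mul_of_nonneg_left ?_ hs0.le
        rw [div_le_iff₀ hc]; linarith
  have hsplit : ∀ w, inner ℝ v (y (θ + w) - x θ)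
      = w * ‖v‖ ^ 2 + inner ℝ v (y (θ + w) - x θ - w • v) := by
    intro w
    rw [inner_sub_right v _ (w • v), inner_smul_right, real_inner_self_eq_norm_sq]; ring
  have hcs : ∀ w, |w| = s → |inner ℝ v (y (θ + w) - x θ - w • v)| ≤ s * ‖v‖ ^ 2 := by
    intro w hw
    refine (abs_real_inner_le_norm _ _).trans ?_
    calc ‖v‖ * _ ≤ ‖v‖ * (s * ‖v‖) := mul_le_mul_of_nonneg_left (hest w hw) (norm_nonneg _)
      _ = _ := by ring
  have hzero : (0 : ℝ) ∈ Icc (inner ℝ v (y (θ - s) - x θ)) (inner ℝ v (y (θ - -s) - x θ)) := by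
    rw [sub_neg_eq_add, sub_eq_add_neg θ s, hsplit, hsplit]
    have h1 := abs_le.1 (hcs (-s) (by rw [abs_neg, abs_of_pos hs0]))
    have h2 := abs_le.1 (hcs s (abs_of_pos hs0))
    constructor
    · linarith [h1.2]
    · linarith [h2.1]
  obtain ⟨Δ, hΔ, h0⟩ := intermediate_value_Icc' (by linarith : -s ≤ s) hψ.continuousOn hzero
  exact ⟨Δ, (abs_le.2 hΔ).trans (min_le_left _ _), h0⟩

end Perturbation

/-! ### First-order expansion of the normal deviation -/

section Expansion

variable {n : ℕ} {f : EuclideanSpace ℝ (Fin n) → EuclideanSpace ℝ (Fin n)} {T : ℝ}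
  {x : ℝ → EuclideanSpace ℝ (Fin n)}
  {g : ℝ → EuclideanSpace ℝ (Fin n) → ℝ → EuclideanSpace ℝ (Fin n)}

theorem exists_norm_pairing_le {m : ℕ} {z : Fin m → ℝ → EuclideanSpace ℝ (Fin n)}
    (hz : ∀ i, Continuous (z i)) (a b : ℝ) :
    ∃ B, 0 ≤ B ∧ ∀ t ∈ Icc a b, ∀ v, ‖pairing z t v‖ ≤ B * ‖v‖ := by
  obtain ⟨B, hB⟩ := (isCompact_Icc (a := a) (b := b)).exists_bound_of_continuousOn
    (f := fun t i => z i t) (continuous_pi hz).continuousOn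
  refine ⟨max B 0, le_max_right _ _, fun t ht v => ?_⟩
  rw [pi_norm_le_iff_of_nonneg (by positivity)]
  intro i
  refine (norm_inner_le_norm (𝕜 := ℝ) (z i t) v).trans
    (mul_le_mul_of_nonneg_right ?_ (norm_nonneg v))
  exact ((norm_le_pi_norm (fun i => z i t) i).trans (hB t ht)).trans (le_max_left _ _)

theorem Matrix.exists_norm_mulVec_le {m : ℕ} (D : Matrix (Fin m) (Fin m) ℝ) :
    ∃ d, 0 ≤ d ∧ ∀ v : Fin m → ℝ, ‖D *ᵥ v‖ ≤ d * ‖v‖ :=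
  ⟨‖(Matrix.toLin' D).toContinuousLinearMap‖, norm_nonneg _, fun v =>
    (Matrix.toLin' D).toContinuousLinearMap.le_opNorm v⟩

variable {z : Fin (n - 1) → ℝ → EuclideanSpace ℝ (Fin n)}

theorem pairing_sub_period {C : Matrix (Fin (n - 1)) (Fin (n - 1)) ℝ}
    (hC : ∀ i t, z i (t - T) = ∑ j, C i j • z j t) (t : ℝ) (v : EuclideanSpace ℝ (Fin n)) :
    pairing z (t - T) v = C *ᵥ pairing z t v := by
  ext i
  simp [pairing_apply, hC, mulVec, dotProduct, sum_inner, inner_smul_left]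

theorem IsCycle.continuous_perturbation (hx : IsCycle f T x)
    (hg : ContinuousOn (fun p : ℝ × EuclideanSpace ℝ (Fin n) × ℝ => g p.1 p.2.1 p.2.2)
      {p | p.2.2 ∈ Icc 0 1}) : Continuous fun t => g t (x t) 0 :=
  hg.comp_continuous (f := fun t => (t, x t, (0 : ℝ)))
    (continuous_id.prodMk (hx.continuous.prodMk continuous_const)) (fun t => by simp)

theorem Mperp_eq_integral_pairing (s : ℝ) :
    Mperp T z g x s = ∫ τ in (s - T)..s, pairing z τ (g τ (x τ) 0) := by
  simp only [Mperp, colMatrix_transpose_mulVec]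

/-- If the normalized defect of `u` is uniformly close to `g(t, x(t), 0)`, then the jump of the
pairing over one period is `ε M^⊥` up to a small error. -/
theorem IsCycle.norm_pairing_sub_sub_Mperp_le (hx : IsCycle f T x)
    (hz : ∀ i, IsAdjointSolution f x (z i))
    (hg : ContinuousOn (fun p : ℝ × EuclideanSpace ℝ (Fin n) × ℝ => g p.1 p.2.1 p.2.2)
      {p | p.2.2 ∈ Icc 0 1})
    {u u' : ℝ → EuclideanSpace ℝ (Fin n)} (hu : ∀ t, HasDerivAt u (u' t) t) {ε B β θ : ℝ}
    (hB : ∀ t ∈ Icc (θ - T) θ, ∀ v, ‖pairing z t v‖ ≤ B * ‖v‖) (hB0 : 0 ≤ B)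
    (hβ : ∀ t ∈ Icc (θ - T) θ, ‖u' t - fderiv ℝ f (x t) (u t) - ε • g t (x t) 0‖ ≤ β) :
    ‖pairing z θ (u θ) - pairing z (θ - T) (u (θ - T)) - ε • Mperp T z g x θ‖ ≤ B * β * T := by
  have hT := hx.period_pos
  have hcont : Continuous fun τ => pairing z τ (g τ (x τ) 0) :=
    (continuous_pairing fun i => (hz i).continuous).comp
      (continuous_id.prodMk (hx.continuous_perturbation hg))
  have hd1 : ∀ t, HasDerivAt (fun t => pairing z t (u t))
      (pairing z t (u' t - fderiv ℝ f (x t) (u t))) t := fun t =>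
    hasDerivAt_pi.2 fun i => (hz i).hasDerivAt_inner (hu t)
  have hd2 : ∀ t, HasDerivAt (fun t => ∫ τ in (θ - T)..t, pairing z τ (g τ (x τ) 0))
      (pairing z t (g t (x t) 0)) t := fun t => hcont.integral_hasStrictDerivAt _ t |>.hasDerivAt
  have hd : ∀ t, HasDerivAt
      (fun t => pairing z t (u t) - ε • ∫ τ in (θ - T)..t, pairing z τ (g τ (x τ) 0))
      (pairing z t (u' t - fderiv ℝ f (x t) (u t)) - ε • pairing z t (g t (x t) 0)) t :=
    fun t => (hd1 t).sub ((hd2 t).const_smul ε)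
  have key := norm_image_sub_le_of_norm_deriv_le_segment' (a := θ - T) (b := θ) (C := B * β)
    (fun t _ => (hd t).hasDerivWithinAt) (fun t ht => by
      rw [← map_smul, ← map_sub]
      exact (hB t ⟨ht.1, ht.2.le⟩ _).trans
        (mul_le_mul_of_nonneg_left (hβ t ⟨ht.1, ht.2.le⟩) hB0)) θ ⟨by linarith, le_rfl⟩
  rw [intervalIntegral.integral_same, smul_zero, sub_zero, ← Mperp_eq_integral_pairing] at key
  rw [sub_right_comm]
  simpa using key

theorem IsCycle.exists_norm_Mperp_le (hx : IsCycle f T x)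
    (hz : ∀ i, IsAdjointSolution f x (z i))
    (hg : ContinuousOn (fun p : ℝ × EuclideanSpace ℝ (Fin n) × ℝ => g p.1 p.2.1 p.2.2)
      {p | p.2.2 ∈ Icc 0 1}) :
    ∃ c, 0 ≤ c ∧ ∀ θ ∈ Icc 0 T, ‖Mperp T z g x θ‖ ≤ c := by
  have hT := hx.period_pos
  have hcont : Continuous fun τ => pairing z τ (g τ (x τ) 0) :=
    (continuous_pairing fun i => (hz i).continuous).comp
      (continuous_id.prodMk (hx.continuous_perturbation hg))
  obtain ⟨c, hc⟩ := (isCompact_Icc (a := -T) (b := T)).exists_bound_of_continuousOn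
    hcont.continuousOn
  refine ⟨max c 0 * T, by positivity, fun θ hθ => ?_⟩
  rw [Mperp_eq_integral_pairing]
  have := intervalIntegral.norm_integral_le_of_norm_le_const (a := θ - T) (b := θ) (C := max c 0)
    (f := fun τ => pairing z τ (g τ (x τ) 0)) (fun τ hτ => by
      rw [uIoc_of_le (by linarith)] at hτ
      exact (hc τ ⟨by linarith [hτ.1, hθ.1], hτ.2.trans hθ.2⟩).trans (le_max_left _ _))
  simpa [abs_of_pos hT] using this

/-- The first order expansion of the deviation from the cycle in the normal hyperplane. -/
theorem IsCycle.exists_norm_pairing_sub_Mperp_le (hf : ContDiff ℝ 1 f) (hx : IsCycle f T x)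
    (hz : ∀ i, IsAdjointSolution f x (z i)) (hind : LinearIndependent ℝ z)
    (horth : ∀ i, inner ℝ (deriv x 0) (z i 0) = 0)
    {C : Matrix (Fin (n - 1)) (Fin (n - 1)) ℝ} (hCdet : IsUnit (1 - C).det)
    (hC : ∀ i t, z i (t - T) = ∑ j, C i j • z j t)
    (hg : ContinuousOn (fun p : ℝ × EuclideanSpace ℝ (Fin n) × ℝ => g p.1 p.2.1 p.2.2)
      {p | p.2.2 ∈ Icc 0 1}) {η : ℝ} (hη : 0 < η) :
    ∃ ρ, 0 < ρ ∧ ∀ ε ∈ Ioc (0 : ℝ) 1, ε ≤ ρ → ∀ y : ℝ → EuclideanSpace ℝ (Fin n),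
      (∀ t, HasDerivAt y (f (y t) + ε • g t (y t) ε) t) → Function.Periodic y T →
      ∀ Δ, |Δ| ≤ ρ → ∀ θ ∈ Icc 0 T, (∀ t, ‖y (t - Δ) - x t‖ ≤ ρ) →
      inner ℝ (f (x θ)) (y (θ - Δ) - x θ) = 0 →
      ‖pairing z θ (y (θ - Δ) - x θ) - ε • ((1 - C)⁻¹ *ᵥ Mperp T z g x θ)‖ ≤ η * ε := by
  have hT := hx.period_pos
  obtain ⟨κ, r, hκ, hr, hgron⟩ := hx.exists_norm_shift_sub_le hf hg
  obtain ⟨R, hR⟩ := hx.exists_norm_le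
  obtain ⟨B, hB0, hB⟩ := exists_norm_pairing_le (fun i => (hz i).continuous) (-T) T
  obtain ⟨d, hd0, hd⟩ := Matrix.exists_norm_mulVec_le (1 - C)⁻¹
  obtain ⟨c, hc0, hc⟩ := hx.exists_norm_le_mul_norm_pairing hf hz hind horth
  obtain ⟨M, hM0, hM⟩ := hx.exists_norm_Mperp_le (z := z) hz hg
  set A := d * B * T * (κ + 1) + 1 with hA
  have hA0 : 0 < A := by positivity
  -- The first bound gives `c * A * η' ≤ 1 / 2`, which absorbs `‖u θ‖`; the second turns the
  -- resulting `O(ε)` bound into the final error `η * ε`.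
  set η' := min (1 / (2 * c * A)) (η / (A * (2 * c * (d * M) + 2))) with hη'
  have hη'0 : 0 < η' := lt_min (by positivity) (by positivity)
  obtain ⟨ρ₁, hρ₁, htay⟩ := hf.exists_norm_sub_sub_fderiv_le R hη'0
  obtain ⟨ρ₂, hρ₂, hguc⟩ := exists_norm_perturbation_sub_le hg (-(T + 1)) (T + 1) (R + 1) hη'0
  refine ⟨min (min ρ₁ ρ₂) (min 1 (r / 2)), by positivity, ?_⟩
  intro ε hε hερ y hy hper Δ hΔ θ hθ hyx horthθ
  simp only [le_min_iff] at hερ hΔ hyx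
  obtain ⟨⟨-, hερ₂⟩, -, hεr⟩ := hερ
  obtain ⟨⟨-, hΔρ₂⟩, hΔ1, -⟩ := hΔ
  have hΔ1' := abs_le.1 hΔ1
  set u := fun t => y (t - Δ) - x t with hu
  have huθ : u (θ - T) = u θ := by
    simp only [hu, hx.periodic.sub_eq, sub_right_comm θ T Δ, hper.sub_eq]
  -- Grönwall starts from `θ - T`, but by periodicity its initial value is `‖u θ‖`, the quantity to
  -- be estimated.
  have hgr : ∀ t ∈ Icc (θ - T) θ, ‖u t‖ ≤ κ * (‖u θ‖ + ε) := by
    intro t ht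
    rw [← huθ]
    refine hgron ε hε y hy Δ hΔ1 (θ - T) ⟨by linarith [hθ.1], by linarith [hθ.2]⟩ ?_ t
      (by simpa using ht)
    linarith [(hyx (θ - T)).2.2]
  have hε0 := hε.1
  have hW := hx.norm_pairing_sub_sub_Mperp_le hz hg (hx.hasDerivAt_shift_sub hy Δ)
    (ε := ε) (B := B) (θ := θ) (β := η' * (κ * (‖u θ‖ + ε)) + ε * η')
    (fun t ht v => hB t ⟨by linarith [ht.1, hθ.1], ht.2.trans hθ.2⟩ v) hB0 (by
      intro t ht
      have hyt : y (t - Δ) = x t + u t := by simp [hu]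
      have hut : ‖u t‖ ≤ 1 := (hyx t).2.1
      have hyR : ‖y (t - Δ)‖ ≤ R + 1 := by
        rw [hyt]; exact (norm_add_le _ _).trans (add_le_add (hR t) hut)
      have h1 := htay (x t) (by simpa using hR t) (u t) (hyx t).1.1
      rw [← hyt] at h1
      have h2 := hguc (t - Δ) ⟨by linarith [ht.1, hθ.1], by linarith [ht.2, hθ.2]⟩ t
        ⟨by linarith [ht.1, hθ.1], by linarith [ht.2, hθ.2]⟩ (y (t - Δ)) (x t) hyR
        ((hR t).trans (by linarith)) ε ⟨hε.1.le, hε.2⟩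
        (by rw [sub_sub_cancel_left, abs_neg]; exact hΔρ₂) (hyx t).1.2 hερ₂
      calc _ = ‖(f (y (t - Δ)) - f (x t) - fderiv ℝ f (x t) (u t)) +
            ε • (g (t - Δ) (y (t - Δ)) ε - g t (x t) 0)‖ := by
            congr 1; rw [smul_sub]; abel
        _ ≤ ‖f (y (t - Δ)) - f (x t) - fderiv ℝ f (x t) (u t)‖ +
            ε * ‖g (t - Δ) (y (t - Δ)) ε - g t (x t) 0‖ := by
          refine (norm_add_le _ _).trans_eq ?_
          rw [norm_smul, Real.norm_of_nonneg hε0.le]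
        _ ≤ _ := by
          refine add_le_add (h1.trans ?_) (mul_le_mul_of_nonneg_left h2 hε0.le)
          exact mul_le_mul_of_nonneg_left (hgr t ht) hη'0.le)
  change ‖pairing z θ (u θ) - pairing z (θ - T) (u (θ - T)) - _‖ ≤ _ at hW
  rw [huθ, pairing_sub_period hC] at hW
  change ‖pairing z θ (u θ) - ε • ((1 - C)⁻¹ *ᵥ Mperp T z g x θ)‖ ≤ η * ε
  have hinv : (1 - C)⁻¹ *ᵥ (pairing z θ (u θ) - C *ᵥ pairing z θ (u θ) - ε • Mperp T z g x θ)
      = pairing z θ (u θ) - ε • ((1 - C)⁻¹ *ᵥ Mperp T z g x θ) := by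
    rw [mulVec_sub, mulVec_smul]
    congr 1
    rw [← one_mulVec (pairing z θ (u θ)), mulVec_mulVec, mul_one, ← sub_mulVec, mulVec_mulVec,
      Matrix.nonsing_inv_mul _ hCdet]
  have hnn : 0 ≤ ‖u θ‖ := norm_nonneg _
  have hest : ‖pairing z θ (u θ) - ε • ((1 - C)⁻¹ *ᵥ Mperp T z g x θ)‖
      ≤ A * η' * (‖u θ‖ + ε) := by
    rw [← hinv]
    calc _ ≤ d * (B * (η' * (κ * (‖u θ‖ + ε)) + ε * η') * T) :=
          (hd _).trans (mul_le_mul_of_nonneg_left hW hd0)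
      _ = d * B * T * η' * (κ * (‖u θ‖ + ε) + ε) := by ring
      _ ≤ d * B * T * η' * ((κ + 1) * (‖u θ‖ + ε)) := by
        refine mul_le_mul_of_nonneg_left ?_ (by positivity)
        linarith
      _ ≤ A * η' * (‖u θ‖ + ε) := by
        rw [hA]
        have : 0 ≤ η' * (‖u θ‖ + ε) := by positivity
        linarith
  have hDM : ‖ε • ((1 - C)⁻¹ *ᵥ Mperp T z g x θ)‖ ≤ ε * (d * M) := by
    rw [norm_smul, Real.norm_of_nonneg hε0.le]
    exact mul_le_mul_of_nonneg_left
      ((hd _).trans (mul_le_mul_of_nonneg_left (hM θ hθ) hd0)) hε0.le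
  have hsmall : c * (A * η') ≤ 1 / 2 := by
    calc c * (A * η') ≤ c * (A * (1 / (2 * c * A))) := by gcongr; exact min_le_left _ _
      _ = 1 / 2 := by field_simp
  -- The normality `horthθ` bounds `‖u θ‖` by its pairing; the term containing `‖u θ‖` on the right
  -- has coefficient at most `1 / 2` and moves to the left.
  have huε : ‖u θ‖ ≤ (2 * c * (d * M) + 1) * ε := by
    have h1 : ‖u θ‖ ≤ c * (A * η' * (‖u θ‖ + ε) + ε * (d * M)) := by
      refine (hc θ hθ (u θ) horthθ).trans (mul_le_mul_of_nonneg_left ?_ hc0.le)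
      refine (norm_le_norm_sub_add _ _).trans (add_le_add hest hDM)
    have h2 : c * (A * η') * (‖u θ‖ + ε) ≤ 1 / 2 * (‖u θ‖ + ε) :=
      mul_le_mul_of_nonneg_right hsmall (by positivity)
    linarith
  calc _ ≤ A * η' * (‖u θ‖ + ε) := hest
    _ ≤ A * (η / (A * (2 * c * (d * M) + 2))) * ((2 * c * (d * M) + 2) * ε) := by
      gcongr
      · exact min_le_right _ _
      · linarith
    _ = η * ε := by field_simp

/-! ### Transversal surfaces and the choice of the shift -/

/-- The linear map `r ↦ ∑ rᵢ zᵢ(t)`. -/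
noncomputable def combination {m : ℕ} (z : Fin m → ℝ → EuclideanSpace ℝ (Fin n)) (t : ℝ) :
    EuclideanSpace ℝ (Fin m) →L[ℝ] EuclideanSpace ℝ (Fin n) :=
  ∑ i, (EuclideanSpace.proj i : EuclideanSpace ℝ (Fin m) →L[ℝ] ℝ).smulRight (z i t)

theorem combination_apply {m : ℕ} (z : Fin m → ℝ → EuclideanSpace ℝ (Fin n)) (t : ℝ)
    (r : EuclideanSpace ℝ (Fin m)) : combination z t r = ∑ i, r i • z i t := by
  simp [combination]

theorem contDiff_combination {m : ℕ} {z : Fin m → ℝ → EuclideanSpace ℝ (Fin n)}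
    (hz : ∀ i, ContDiff ℝ 1 (z i)) :
    ContDiff ℝ 1 fun p : ℝ × EuclideanSpace ℝ (Fin m) => combination z p.1 p.2 := by
  simp only [combination_apply]
  refine ContDiff.sum fun i _ => ContDiff.fun_smul ?_ ((hz i).comp contDiff_fst)
  exact (EuclideanSpace.proj i : EuclideanSpace ℝ (Fin m) →L[ℝ] ℝ).contDiff.comp contDiff_snd

theorem IsCycle.injective_combination (hf : ContDiff ℝ 1 f) (hx : IsCycle f T x)
    (hz : ∀ i, IsAdjointSolution f x (z i)) (hind : LinearIndependent ℝ z) (t : ℝ) :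
    Function.Injective (combination z t) := by
  rw [injective_iff_map_eq_zero]
  intro r hr
  rw [combination_apply] at hr
  ext i
  exact Fintype.linearIndependent_iff.1 (hx.linearIndependent_apply hf hz hind t) r hr i

theorem IsCycle.isTransversalSurface (hf : ContDiff ℝ 1 f) (hx : IsCycle f T x)
    (hz : ∀ i, IsAdjointSolution f x (z i)) (hind : LinearIndependent ℝ z)
    (horth : ∀ i, inner ℝ (deriv x 0) (z i 0) = 0) (θ : ℝ) :
    IsTransversalSurface x θ fun r => x θ + combination z θ r := by
  have hinj := hx.injective_combination hf hz hind θ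
  have hd : ∀ r, fderiv ℝ (fun r => x θ + combination z θ r) r = combination z θ := fun r => by
    rw [fderiv_const_add, ContinuousLinearMap.fderiv]
  refine ⟨contDiff_const.add (combination z θ).contDiff,
    (add_right_injective _).comp hinj, fun r => by rwa [hd], by simp, ?_⟩
  rw [hd, hx.deriv_eq]
  rintro ⟨r, hr⟩
  have : inner ℝ (combination z θ r) (f (x θ)) = 0 := by
    simp [combination_apply, sum_inner, inner_smul_left,
      hx.inner_velocity_eq_zero hf (hz _) (horth _)]
  rw [hr] at this
  exact hx.velocity_ne_zero hf θ (inner_self_eq_zero.1 this)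

theorem IsCycle.exists_mem_image_ball (hf : ContDiff ℝ 1 f) (hx : IsCycle f T x)
    (hz : ∀ i, IsAdjointSolution f x (z i)) (hind : LinearIndependent ℝ z)
    (horth : ∀ i, inner ℝ (deriv x 0) (z i 0) = 0) :
    ∃ ρ, 0 < ρ ∧ ∀ θ ∈ Icc 0 T, ∀ p, inner ℝ (f (x θ)) (p - x θ) = 0 → ‖p - x θ‖ ≤ ρ →
      p ∈ (fun r => x θ + combination z θ r) '' Metric.ball 0 1 := by
  obtain ⟨c, hc, h⟩ := (isCompact_Icc (a := 0) (b := T)).exists_norm_le_mul_norm_of_injective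
    (contDiff_combination fun i => (hz i).contDiff hf hx.continuous).continuous
    (fun t _ => hx.injective_combination hf hz hind t)
  refine ⟨1 / (2 * c), by positivity, fun θ hθ p hp hpρ => ?_⟩
  have hmem : p - x θ ∈ Submodule.span ℝ (range fun i => z i θ) := by
    rw [hx.span_eq_orthogonal hf hz hind horth]
    exact Submodule.mem_orthogonal_singleton_iff_inner_right.2 hp
  obtain ⟨r, hr⟩ := (Submodule.mem_span_range_iff_exists_fun ℝ).1 hmem
  have hr' : combination z θ (WithLp.toLp 2 r) = p - x θ := by simpa [combination_apply] using hr
  refine ⟨WithLp.toLp 2 r, ?_, by simp [hr']⟩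
  rw [mem_ball_zero_iff]
  calc _ ≤ c * ‖p - x θ‖ := by simpa [hr'] using h θ hθ (WithLp.toLp 2 r)
    _ ≤ c * (1 / (2 * c)) := mul_le_mul_of_nonneg_left hpρ hc.le
    _ = 1 / 2 := by field_simp
    _ < 1 := by norm_num

/-- The shift of smallest absolute value that puts a point of `y` on the normal hyperplane. -/
theorem exists_minimal_shift_orthogonal {E : Type*} [NormedAddCommGroup E] [InnerProductSpace ℝ E]
    {y : ℝ → E} (hy : Continuous y) (θ : ℝ) (v p : E) :
    ∃ Δ₀ : ℝ, ∀ Δ, inner ℝ v (y (θ - Δ) - p) = 0 →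
      |Δ₀| ≤ |Δ| ∧ inner ℝ v (y (θ - Δ₀) - p) = 0 := by
  have hclosed : IsClosed {Δ : ℝ | inner ℝ v (y (θ - Δ) - p) = 0} :=
    isClosed_eq (continuous_const.inner
      ((hy.comp (continuous_const.sub continuous_id)).sub continuous_const)) continuous_const
  rcases {Δ : ℝ | inner ℝ v (y (θ - Δ) - p) = 0}.eq_empty_or_nonempty with he | hne
  -- When no shift works, the value `0` is arbitrary and the claim is vacuous.
  · exact ⟨0, fun Δ hΔ => absurd (show Δ ∈ {Δ : ℝ | inner ℝ v (y (θ - Δ) - p) = 0} from hΔ)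
      (by simp [he])⟩
  · obtain ⟨Δ₀, hmem, h0⟩ := hclosed.exists_infDist_eq_dist hne 0
    refine ⟨Δ₀, fun Δ hΔ => ⟨?_, hmem⟩⟩
    have := Metric.infDist_le_dist_of_mem (x := (0 : ℝ))
      (show Δ ∈ {Δ : ℝ | inner ℝ v (y (θ - Δ) - p) = 0} from hΔ)
    rwa [h0, dist_zero_left, dist_zero_left] at this

end Expansion

/-! ### The main theorem -/

theorem theorem3p2 {n : ℕ}
    (f : EuclideanSpace ℝ (Fin n) → EuclideanSpace ℝ (Fin n)) (hf : ContDiff ℝ 1 f)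
    (T : ℝ) (xt : ℝ → EuclideanSpace ℝ (Fin n)) (hxt : IsSimpleCycle f T xt)
    (z : Fin (n - 1) → ℝ → EuclideanSpace ℝ (Fin n))
    (hz_sol : ∀ i, IsAdjointSolution f xt (z i))
    (hz_ind : LinearIndependent ℝ z)
    (hz_per : ∀ i, ¬ Function.Periodic (z i) T)
    (hz_orth : ∀ i, inner ℝ (deriv xt 0) (z i 0) = 0) :
    -- `D` and the surfaces `I θ` depend only on the unperturbed system and on the `z i`
    ∃ (D : Matrix (Fin (n - 1)) (Fin (n - 1)) ℝ)
      (I : ℝ → EuclideanSpace ℝ (Fin (n - 1)) → EuclideanSpace ℝ (Fin n)),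
      IsUnit D.det ∧
      ContDiff ℝ 1 (fun p : ℝ × EuclideanSpace ℝ (Fin (n - 1)) => I p.1 p.2) ∧
      (∀ θ ∈ Icc 0 T, IsTransversalSurface xt θ (I θ)) ∧
      ∀ (g : ℝ → EuclideanSpace ℝ (Fin n) → ℝ → EuclideanSpace ℝ (Fin n)),
        ContinuousOn
          (fun p : ℝ × EuclideanSpace ℝ (Fin n) × ℝ => g p.1 p.2.1 p.2.2)
          {p | p.2.2 ∈ Icc 0 1} →
        (∀ t ξ, ∀ ε ∈ Icc (0 : ℝ) 1, g (t + T) ξ ε = g t ξ ε) →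
        ∀ (ε : ℕ → ℝ) (x : ℕ → ℝ → EuclideanSpace ℝ (Fin n)),
          (∀ k, ε k ∈ Ioc 0 1) →
          Tendsto ε atTop (𝓝 0) →
          (∀ k t, HasDerivAt (x k) (f (x k t) + ε k • g t (x k t) (ε k)) t) →
          (∀ k, Function.Periodic (x k) T) →
          (∀ t, Tendsto (fun k => x k t) atTop (𝓝 (xt t))) →
          ∃ Δ : ℕ → ℝ → ℝ,
            TendstoUniformlyOn Δ (fun _ => 0) atTop (Icc 0 T) ∧
            (∀ᶠ k in atTop, ∀ θ ∈ Icc 0 T,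
              x k (θ - Δ k θ) ∈ I θ '' Metric.ball 0 1) ∧
            -- the remainder divided by `ε k` tends to zero, uniformly in `θ`
            TendstoUniformlyOn
              (fun k θ => (ε k)⁻¹ •
                ((colMatrix z θ)ᵀ *ᵥ (x k (θ - Δ k θ) - xt θ).ofLp -
                  ε k • (D *ᵥ Mperp T z g xt θ)))
              (fun _ => 0) atTop (Icc 0 T) := by
  have hx := hxt.isCycle
  obtain ⟨C, hCdet, hC⟩ := hxt.exists_translation_matrix hf hz_sol hz_ind hz_orth
  have hxC1 : ContDiff ℝ 1 xt := contDiff_one_iff_deriv.2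
    ⟨fun t => (hx.isSolution t).differentiableAt, by
      rw [funext hx.deriv_eq]; exact hf.continuous.comp hx.continuous⟩
  refine ⟨(1 - C)⁻¹, fun θ r => xt θ + combination z θ r, Matrix.isUnit_nonsing_inv_det _ hCdet,
    (hxC1.comp contDiff_fst).add
      (contDiff_combination fun i => (hz_sol i).contDiff hf hx.continuous),
    fun θ _ => hx.isTransversalSurface hf hz_sol hz_ind hz_orth θ, ?_⟩
  intro g hg _ ε x hε hε0 hsol hper hlim
  have hcont : ∀ k, Continuous (x k) := fun k =>
    continuous_iff_continuousAt.2 fun t => (hsol k t).continuousAt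
  -- Existence of a shift below `ρ` holds only for `k` large depending on `ρ`. Taking the shift of
  -- least absolute value gives one function `Δ k` that inherits all these bounds.
  choose Δ hΔ using fun k θ =>
    exists_minimal_shift_orthogonal (hcont k) θ (f (xt θ)) (xt θ)
  have hunif := fun ρ (hρ : 0 < ρ) => hx.eventually_norm_sub_le hf hg hε hε0 hsol hper (hlim 0) hρ
  have hshift : ∀ ρ, 0 < ρ → ∀ᶠ k in atTop, ∀ θ ∈ Icc 0 T,
      |Δ k θ| ≤ ρ ∧ inner ℝ (f (xt θ)) (x k (θ - Δ k θ) - xt θ) = 0 := by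
    intro ρ hρ
    obtain ⟨σ, hσ, h⟩ := hx.exists_shift_orthogonal hf hρ
    filter_upwards [hunif σ hσ] with k hk θ hθ
    obtain ⟨Δ', hΔ', h0⟩ := h (x k) (hcont k) hk θ hθ
    exact ⟨(hΔ k θ Δ' h0).1.trans hΔ', (hΔ k θ Δ' h0).2⟩
  have hxuc : ∀ ρ, 0 < ρ → ∃ δ, 0 < δ ∧ ∀ Δ t, |Δ| ≤ δ → ‖xt (t - Δ) - xt t‖ ≤ ρ := by
    intro ρ hρ
    obtain ⟨K, hK⟩ := (hx.periodic.comp f).exists_norm_le hx.period_pos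
      (hf.continuous.comp hx.continuous)
    have hK0 : 0 ≤ K := (norm_nonneg _).trans (hK 0)
    refine ⟨ρ / (K + 1), by positivity, fun Δ t hΔ => ?_⟩
    have := convex_univ.norm_image_sub_le_of_norm_hasDerivWithin_le
      (fun s _ => (hx.isSolution s).hasDerivWithinAt) (fun s _ => hK s) (mem_univ t)
      (mem_univ (t - Δ))
    rw [sub_sub_cancel_left, norm_neg, Real.norm_eq_abs] at this
    rw [le_div_iff₀ (by positivity)] at hΔ
    nlinarith [abs_nonneg Δ]
  have hdev : ∀ ρ, 0 < ρ → ∀ᶠ k in atTop, ∀ θ ∈ Icc 0 T, ∀ t,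
      ‖x k (t - Δ k θ) - xt t‖ ≤ ρ := by
    intro ρ hρ
    obtain ⟨δ, hδ, h⟩ := hxuc (ρ / 2) (by positivity)
    filter_upwards [hshift δ hδ, hunif (ρ / 2) (by positivity)] with k h1 h2 θ hθ t
    have h3 := norm_sub_le_norm_sub_add_norm_sub (x k (t - Δ k θ)) (xt (t - Δ k θ)) (xt t)
    linarith [h2 (t - Δ k θ), h (Δ k θ) t (h1 θ hθ).1]
  refine ⟨Δ, ?_, ?_, ?_⟩
  · rw [Metric.tendstoUniformlyOn_iff]
    intro η hη
    filter_upwards [hshift (η / 2) (by positivity)] with k hk θ hθ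
    rw [dist_zero_left, Real.norm_eq_abs]
    linarith [(hk θ hθ).1]
  · obtain ⟨ρ, hρ, h⟩ := hx.exists_mem_image_ball hf hz_sol hz_ind hz_orth
    filter_upwards [hshift 1 one_pos, hdev ρ hρ] with k h1 h2 θ hθ
    exact h θ hθ _ (h1 θ hθ).2 (h2 θ hθ θ)
  · rw [Metric.tendstoUniformlyOn_iff]
    intro η hη
    -- Using `η / 2` converts the non-strict estimate into the strict one required for uniform
    -- convergence.
    obtain ⟨ρ, hρ, h⟩ := hx.exists_norm_pairing_sub_Mperp_le hf hz_sol hz_ind hz_orth hCdet hC hg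
      (half_pos hη)
    filter_upwards [hshift ρ hρ, hdev ρ hρ, hε0.eventually_le_const hρ] with k h1 h2 h3 θ hθ
    have hεk := (hε k).1
    have := h (ε k) (hε k) h3 (x k) (hsol k) (hper k) (Δ k θ) (h1 θ hθ).1 θ hθ (h2 θ hθ)
      (h1 θ hθ).2
    rw [dist_zero_left, colMatrix_transpose_mulVec, norm_smul, norm_inv,
      Real.norm_of_nonneg hεk.le, inv_mul_lt_iff₀ hεk]
    nlinarith
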